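/- Let $K$ be a simplicial 2-complex with vertex set $V$ that triangulates an open domain $D\subseteq\mathbb C$ (a nonempty connected open set), i.e. the geometric realization of $K$ is homeomorphic to $D$. Assume that the 1-skeleton of $K$ is recurrent: from every starting vertex, the simple random walk on it almost surely visits every vertex infinitely many times. A label for $K$ is a function $\rho:V\to(0,\infty)$. For a face $\triangle=\langle u,v,w\rangle$ of $K$ put $$\alpha_\rho(v,\triangle)=\arccos\left[\frac{(\rho(v)+\rho(u))^2+(\rho(v)+\rho(w))^2-(\rho(u)+\rho(w))^2}{2(\rho(v)+\rho(u))(\rho(v)+\rho(w))}\right],$$ and let $\Theta_\rho(v)=\sum_{\triangle\ni v}\alpha_\rho(v,\triangle)$, the sum being over the (finitely many) two-dimensional faces of $K$ that contain $v$. Let $\rho$ and $\tilde\rho$ be labels for $K$ such that $K(\tilde\rho)$ is a subpacking for $\Theta_\rho$, that is, $\Theta_{\tilde\rho}(v)\ge\Theta_\rho(v)$ for every $v\in V$. Then the function $A:V\to(0,\infty)$, $A(v)=\tilde\rho(v)/\rho(v)$, is bounded if and only if it is constant. -/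

import Mathlib

open Filter MeasureTheory

noncomputable section

namespace LabelledComplex

/-! ### Simplicial 2-complexes triangulating plane domains -/

section Complexes

variable {V : Type*}

/-- The points of the geometric realization `|K|`, in barycentric coordinates: the nonnegative
functions on the vertices with total mass `1` that are supported in a face of `K`. -/
def Realization (K : AbstractSimplicialComplex V) : Type _ :=
  {x : V → ℝ // (∀ v, 0 ≤ x v) ∧
    ∃ s ∈ K.faces, Function.support x ⊆ (s : Set V) ∧ ∑ v ∈ s, x v = 1}

/-- The closed simplex of `|K|` spanned by the finite vertex set `s`. -/
def ClosedSimplex (K : AbstractSimplicialComplex V) (s : Finset V) : Type _ :=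
  {x : Realization K // Function.support x.1 ⊆ (s : Set V)}

/-- A closed simplex carries the Euclidean topology of its barycentric coordinates. -/
instance (K : AbstractSimplicialComplex V) (s : Finset V) :
    TopologicalSpace (ClosedSimplex K s) :=
  TopologicalSpace.induced (fun x => (x.1.1 : V → ℝ)) inferInstance

/-- The usual (weak, or coherent) topology of the geometric realization: a set is open iff its
trace on every closed simplex of `K` is open. -/
instance (K : AbstractSimplicialComplex V) : TopologicalSpace (Realization K) :=
  ⨆ s : K.faces, TopologicalSpace.coinduced
    (fun x : ClosedSimplex K (s : Finset V) => (x.1 : Realization K)) inferInstance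

/-- `K` is a triangulation of the plane set `D`: it is a complex of dimension at most two whose
geometric realization is homeomorphic to `D`. -/
def IsTriangulationOf (K : AbstractSimplicialComplex V) (D : Set ℂ) : Prop :=
  (∀ s ∈ K.faces, s.card ≤ 3) ∧ Nonempty (Realization K ≃ₜ D)

open Classical in
/-- The 1-skeleton of `K`, as a graph on the vertices of `K`. -/
def oneSkeleton (K : AbstractSimplicialComplex V) : SimpleGraph V where
  Adj u v := u ≠ v ∧ ({u, v} : Finset V) ∈ K.faces
  symm := ⟨fun u v h => ⟨h.1.symm, by rw [Finset.pair_comm]; exact h.2⟩⟩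
  loopless := ⟨fun _ h => h.1 rfl⟩

/-! ### Labels and angle sums -/

/-- A label is a positive function on the vertices. -/
def IsLabel (ρ : V → ℝ) : Prop := ∀ v, 0 < ρ v

open Classical in
/-- The angle at the vertex `v` of the triangle `Δ`, which is laid out in the plane as the triangle
of centers of three mutually externally tangent circles of radii `ρ`. The sums and the product run
over the two vertices of `Δ` other than `v`; see `angle_eq` for the form with named vertices. -/
def angle (ρ : V → ℝ) (v : V) (Δ : Finset V) : ℝ :=
  Real.arccos ((∑ u ∈ Δ.erase v, (ρ v + ρ u) ^ 2 - (∑ u ∈ Δ.erase v, ρ u) ^ 2) /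
    (2 * ∏ u ∈ Δ.erase v, (ρ v + ρ u)))

open Classical in
theorem angle_eq (ρ : V → ℝ) {u v w : V} (huv : u ≠ v) (hvw : v ≠ w) (huw : u ≠ w) :
    angle ρ v {u, v, w} =
      Real.arccos (((ρ v + ρ u) ^ 2 + (ρ v + ρ w) ^ 2 - (ρ u + ρ w) ^ 2) /
        (2 * (ρ v + ρ u) * (ρ v + ρ w))) := by
  have h : ({u, v, w} : Finset V).erase v = {u, w} := by
    ext x
    simp only [Finset.mem_erase, Finset.mem_insert, Finset.mem_singleton]
    grind
  rw [angle, h, Finset.sum_pair huw, Finset.sum_pair huw, Finset.prod_pair huw, mul_assoc]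

/-- The angle sum at `v`: the sum of the angles at `v` of all triangles of `K` that contain `v`
(finitely many when `K` triangulates an open plane set). -/
def angleSum (K : AbstractSimplicialComplex V) (ρ : V → ℝ) (v : V) : ℝ :=
  ∑ᶠ (Δ : Finset V) (_ : Δ ∈ K.faces ∧ Δ.card = 3 ∧ v ∈ Δ), angle ρ v Δ

/-- The labelled complex `K(ρ)` is a subpacking for `Θ`. Angle sums are compared at the interior
vertices; a complex that triangulates an open plane set has no boundary, so these are all of its
vertices. -/
def IsSubpacking (K : AbstractSimplicialComplex V) (ρ : V → ℝ) (Θ : V → ℝ) : Prop :=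
  ∀ v, Θ v ≤ angleSum K ρ v

end Complexes

/-! ### Random walks -/

section Walks

variable {V : Type*}

/-- The infinite sequences of vertices. -/
def PathSpace (V : Type*) : Type _ := ℕ → V

/-- The product σ-algebra, the vertices being discrete. -/
instance (V : Type*) : MeasurableSpace (PathSpace V) :=
  @MeasurableSpace.pi ℕ (fun _ => V) (fun _ => ⊤)

open Classical in
/-- The transition probabilities of the simple random walk: `1 / δ(v)` from `v` to each of its
`δ(v)` neighbours. -/
def simpleTransition (G : SimpleGraph V) (v w : V) : ℝ :=
  if G.Adj v w then 1 / ((G.neighborSet v).ncard : ℝ) else 0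

open Classical in
/-- `μ` is the law of the random walk with transition probabilities `p` started at `a`: it is a
probability measure whose values on cylinders are the products of the transition probabilities
(on countably many vertices there is at most one such measure). -/
def IsWalkLaw (p : V → V → ℝ) (a : V) (μ : Measure (PathSpace V)) : Prop :=
  IsProbabilityMeasure μ ∧ ∀ (n : ℕ) (x : ℕ → V),
    μ.real {ω | ∀ i ≤ n, ω i = x i} =
      (if x 0 = a then 1 else 0) * ∏ i ∈ Finset.range n, p (x i) (x (i + 1))

/-- The random walk is recurrent: whatever its starting vertex, almost surely it visits every
vertex infinitely many times. -/
def IsRecurrentWalk (p : V → V → ℝ) : Prop :=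
  ∀ a, ∃ μ : Measure (PathSpace V), IsWalkLaw p a μ ∧
    ∀ᵐ ω ∂μ, ∀ w, ∃ᶠ n in atTop, ω n = w

/-- A graph is recurrent if its simple random walk is. -/
def IsRecurrentGraph (G : SimpleGraph V) : Prop :=
  IsRecurrentWalk (simpleTransition G)

end Walks

end LabelledComplex

end

noncomputable section

namespace LabelledComplex

open unitInterval Topology

/-! Put `h = log (ρ' / ρ)` and join the labels by the geometric interpolation `ρ * exp (t * h)`. For
a triangle of mutually tangent circles with inradius `r`, the derivative of the angle at `v` is the
sum of `r / (ρ v + ρ w) * (h w - h v)` over the other two vertices `w`, and this weight is symmetric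
in `v` and `w`. Integrating over `t` in `[0, 1]` and summing over triangles turns the difference of
the angle sums at `v` into a network Laplacian of `h` (`angleSum_sub_angleSum`). A subpacking thus
makes `h` subharmonic, and if `ρ' / ρ` is bounded, a constant minus `h` is positive and
superharmonic.

It remains to prove a Liouville theorem for this network (`IsRecurrentGraph.superharmonic_const`).
Recurrence yields finitely supported functions equal to 1 at a given vertex with arbitrarily small
energy for unit conductances. Since the conductances of the network are at most 1, its energy is no
larger, and this forces positive superharmonic functions to be constant.

The conductance bounds need plane topology: every edge lies in a triangle, so its conductance is
positive, and in at most two, each contributing at most 1/2. Both facts follow from a weak form of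
invariance of domain (`range_mem_nhds_of_closedBall`), proved with continuous logarithms on the
circle. -/

/-! ### Injective images of discs in the plane -/

/-- Continuous logarithms can be transported along homotopies of nonvanishing functions. -/
theorem exists_log_of_homotopy {A : Type*} [TopologicalSpace A] (H : I × A → ℂ)
    (hH : Continuous H) (hne : ∀ x, H x ≠ 0) (L : A → ℂ) (hL : Continuous L)
    (h0 : ∀ a, Complex.exp (L a) = H (0, a)) :
    ∃ L' : A → ℂ, Continuous L' ∧ ∀ a, Complex.exp (L' a) = H (1, a) := by
  let H' : C(I × A, {z : ℂ // z ≠ 0}) := ⟨fun x => ⟨H x, hne x⟩, by fun_prop⟩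
  have hz : ∀ a, H' (0, a) = (⟨Complex.exp ((⟨L, hL⟩ : C(A, ℂ)) a), Complex.exp_ne_zero _⟩ :
      {z : ℂ // z ≠ 0}) := fun a => Subtype.ext (h0 a).symm
  refine ⟨fun a => Complex.isCoveringMap_exp.liftHomotopy H' ⟨L, hL⟩ hz (1, a), by fun_prop, ?_⟩
  intro a
  exact congrArg Subtype.val
    (congrFun (Complex.isCoveringMap_exp.liftHomotopy_lifts H' ⟨L, hL⟩ hz) (1, a))

/-- An odd nonvanishing function on the circle has no continuous logarithm. -/
theorem no_log_of_odd (L : Circle → ℂ) (hL : Continuous L)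
    (hodd : ∀ z, Complex.exp (L (-z)) = - Complex.exp (L z)) : False := by
  -- Both sides are lifts of the same map through `exp` and agree at 1, hence everywhere. Evaluating
  -- at -1 gives `L 1 = L (-1)`, against oddness.
  have h := Complex.isCoveringMap_exp.eq_of_comp_eq (A := Circle) (g₁ := fun z => L (-z))
    (g₂ := fun z => L z + (L (-1) - L 1)) (by fun_prop) (by fun_prop) (by
      ext z
      simp only [Function.comp, hodd, Complex.exp_add, Complex.exp_sub]
      have := Complex.exp_ne_zero (L 1)
      field_simp) 1 (by ring)
  have h1 := congrFun h (-1)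
  simp only [neg_neg] at h1
  have h2 : L 1 = L (-1) := by linear_combination (1/2) * h1
  have h3 := hodd 1
  rw [← h2] at h3
  exact Complex.exp_ne_zero (L 1) (by linear_combination (1/2) * h3)

/-- An injective continuous image of the closed disc in the plane is a neighbourhood of the image
of the centre. -/
theorem image_closedBall_mem_nhds (f : ℂ → ℂ) (hf : ContinuousOn f (Metric.closedBall 0 1))
    (hinj : Set.InjOn f (Metric.closedBall 0 1)) : f '' Metric.closedBall 0 1 ∈ 𝓝 (f 0) := by
  have h0 : (0 : ℂ) ∈ Metric.closedBall (0 : ℂ) 1 := by simp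
  have hmem : ∀ (t : I) (z : Circle), (t : ℂ) * z ∈ Metric.closedBall (0 : ℂ) 1 := by
    intro t z
    simpa [abs_of_nonneg t.2.1, Circle.norm_coe z] using t.2.2
  have hmem' : ∀ (t : I) (z : Circle), -((t : ℂ) * z) ∈ Metric.closedBall (0 : ℂ) 1 := by
    intro t z
    simpa using hmem t z
  have hmem1 : ∀ z : Circle, (z : ℂ) ∈ Metric.closedBall (0 : ℂ) 1 :=
    fun z => by simp [Circle.norm_coe z]
  have hcz : Continuous fun z : Circle => f z := hf.comp_continuous (by fun_prop) hmem1
  have hfz : ∀ z : Circle, f z - f 0 ≠ 0 := fun z h => by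
    have := hinj (hmem1 z) h0 (sub_eq_zero.1 h)
    simp at this
  -- The radius of the ball is the distance from `f 0` to the image of the boundary circle.
  obtain ⟨z₀, hz₀⟩ := (isCompact_univ (X := Circle)).exists_isMinOn Set.univ_nonempty
    (f := fun z : Circle => ‖f z - f 0‖) (hcz.sub continuous_const).norm.continuousOn
  rw [Metric.mem_nhds_iff]
  refine ⟨‖f z₀ - f 0‖, norm_pos_iff.2 (hfz z₀), fun p hp => ?_⟩
  by_contra hpn
  have hpn' : ∀ w ∈ Metric.closedBall (0 : ℂ) 1, f w - p ≠ 0 := fun w hw h =>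
    hpn ⟨w, hw, sub_eq_zero.1 h⟩
  -- If the image misses `p`, contracting the disc to its centre gives a logarithm of `f z - p` on
  -- the circle.
  obtain ⟨L₁, hL₁, hL₁'⟩ := exists_log_of_homotopy (A := Circle)
    (fun x : I × Circle => f ((x.1 : ℂ) * x.2) - p)
    ((hf.comp_continuous (f := fun x : I × Circle => (x.1 : ℂ) * x.2) (by fun_prop)
      (fun x => hmem x.1 x.2)).sub continuous_const)
    (fun x => hpn' _ (hmem _ _)) (fun _ => Complex.log (f 0 - p)) continuous_const
    (fun a => by simp [Complex.exp_log (hpn' 0 h0)])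
  -- This is the quotient `(f z - p) / (f z - f 0)`. It has positive real part, so `f z - f 0` has a
  -- logarithm as well.
  have hs : ∀ z : Circle, 1 - (p - f 0) / (f z - f 0) ∈ Complex.slitPlane := by
    intro z
    have h1 : ‖(p - f 0) / (f z - f 0)‖ < 1 := by
      rw [norm_div, div_lt_one (norm_pos_iff.2 (hfz z))]
      exact (mem_ball_iff_norm.1 hp).trans_le (hz₀.2 (Set.mem_univ z))
    left
    have := (Complex.abs_re_le_norm _).trans_lt h1
    rw [abs_lt] at this
    simp only [Complex.sub_re, Complex.one_re]
    linarith [this.2]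
  -- The homotopy `f z - f (-t z)` runs from `f z - f 0` to an odd function and does not vanish, by
  -- injectivity.
  obtain ⟨L₃, hL₃, hL₃'⟩ := exists_log_of_homotopy (A := Circle)
    (fun x : I × Circle => f x.2 - f (-((x.1 : ℂ) * x.2)))
    ((hcz.comp continuous_snd).sub (hf.comp_continuous
      (f := fun x : I × Circle => -((x.1 : ℂ) * x.2)) (by fun_prop) (fun x => hmem' x.1 x.2)))
    (fun x h => by
      have := hinj (hmem1 x.2) (hmem' x.1 x.2) (sub_eq_zero.1 h)
      have h2 : (1 + (x.1 : ℂ)) * x.2 = 0 := by linear_combination this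
      rcases mul_eq_zero.1 h2 with h3 | h3
      · have h4 := congrArg Complex.re h3
        simp at h4
        linarith [x.1.2.1]
      · simp at h3)
    (fun z => L₁ z - Complex.log (1 - (p - f 0) / (f z - f 0)))
    (hL₁.sub (Continuous.clog (continuous_const.sub
      (continuous_const.div (hcz.sub continuous_const) hfz)) hs))
    (fun z => by
      rw [Complex.exp_sub, hL₁', Complex.exp_log (Complex.slitPlane_ne_zero (hs z))]
      have h1 := hfz z
      have h2 := hpn' z (hmem1 z)
      have h3 : 1 - (p - f 0) / (f z - f 0) = (f z - p) / (f z - f 0) := by field_simp; ring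
      rw [h3]
      simp only [Set.Icc.coe_one, Complex.ofReal_one, one_mul, Set.Icc.coe_zero,
        Complex.ofReal_zero, zero_mul, neg_zero]
      field_simp)
  refine no_log_of_odd L₃ hL₃ fun z => ?_
  rw [hL₃', hL₃']
  simp

/-- The image of the closed disc under an injective continuous map is a neighbourhood of the image
of the centre. -/
theorem range_mem_nhds_of_closedBall (f : Metric.closedBall (0 : ℂ) 1 → ℂ) (hf : Continuous f)
    (hinj : Function.Injective f) : Set.range f ∈ 𝓝 (f ⟨0, by simp⟩) := by
  classical
  let F : ℂ → ℂ := fun z => if h : z ∈ Metric.closedBall (0 : ℂ) 1 then f ⟨z, h⟩ else 0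
  have hF : ∀ z : Metric.closedBall (0 : ℂ) 1, F z = f z := fun z => dif_pos z.2
  have h := image_closedBall_mem_nhds F
    (continuousOn_iff_continuous_domRestrict.2 (hf.congr fun z => (hF z).symm))
    (fun x hx y hy hxy => by
      have := hinj ((hF ⟨x, hx⟩).symm.trans (hxy.trans (hF ⟨y, hy⟩)))
      exact congrArg Subtype.val this)
  rw [show F 0 = f ⟨0, by simp⟩ from hF ⟨0, by simp⟩] at h
  refine Filter.mem_of_superset h ?_
  rintro _ ⟨z, hz, rfl⟩
  exact ⟨⟨z, hz⟩, (hF ⟨z, hz⟩).symm⟩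

/-! ### The triangles at an edge of a triangulated plane domain -/

section EdgeTriangles

variable {V : Type*} {K : AbstractSimplicialComplex V}

theorem continuous_realization_dom {X : Type*} [TopologicalSpace X] {g : Realization K → X}
    (h : ∀ s ∈ K.faces, Continuous fun x : ClosedSimplex K s => g x.1) : Continuous g := by
  rw [continuous_iSup_dom]
  intro s
  rw [continuous_coinduced_dom]
  exact h s s.2

theorem continuous_coord (v : V) : Continuous fun x : Realization K => x.1 v := by
  refine continuous_realization_dom fun s _ => ?_
  exact (continuous_apply v).comp continuous_induced_dom

theorem continuous_to_realization {X : Type*} [TopologicalSpace X] {s : Finset V}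
    (hs : s ∈ K.faces) {φ : X → Realization K} (hφ : ∀ x, Function.support (φ x).1 ⊆ (s : Set V))
    (hc : ∀ v, Continuous fun x => (φ x).1 v) : Continuous φ := by
  let i : X → ClosedSimplex K s := fun x => ⟨φ x, hφ x⟩
  have h1 : Continuous i := continuous_induced_rng.2 (continuous_pi hc)
  have h2 : Continuous fun x : ClosedSimplex K s => (x.1 : Realization K) :=
    continuous_iff_coinduced_le.2 (le_iSup (fun s : K.faces => TopologicalSpace.coinduced
      (fun x : ClosedSimplex K (s : Finset V) => (x.1 : Realization K)) inferInstance) ⟨s, hs⟩)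
  exact h2.comp h1

theorem realization_support_mem (x : Realization K) :
    ∃ s ∈ K.faces, (∀ v, v ∈ s ↔ 0 < x.1 v) ∧ ∑ v ∈ s, x.1 v = 1 := by
  classical
  obtain ⟨h0, s, hs, hsub, hsum⟩ := x.2
  have hsum' : ∑ v ∈ s.filter (fun v => 0 < x.1 v), x.1 v = 1 := by
    rw [Finset.sum_filter_of_ne, hsum]
    exact fun v _ hv => (h0 v).lt_of_ne hv.symm
  refine ⟨s.filter (fun v => 0 < x.1 v), (K.isRelLowerSet_faces hs).2 (Finset.filter_subset _ _) ?_,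
    fun v => ?_, hsum'⟩
  · by_contra h
    rw [Finset.not_nonempty_iff_eq_empty] at h
    simp [h] at hsum'
  · simp only [Finset.mem_filter, and_iff_right_iff_imp]
    exact fun hv => hsub hv.ne'

open Classical in
/-- Barycentric coordinates on the union of the triangles `{a, b, c}` and `{a, b, d}`, which is laid
out in the closed unit disc with `{a, b}` along the real axis. -/
def bookCoord (a b c d : V) (z : ℂ) (v : V) : ℝ :=
  if v = a then 1 / 2 - |z.im| / 4 + z.re / 4 else
  if v = b then 1 / 2 - |z.im| / 4 - z.re / 4 else
  if v = c then max z.im 0 / 2 else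
  if v = d then max (-z.im) 0 / 2 else 0

theorem continuous_bookCoord (a b c d v : V) : Continuous fun z => bookCoord a b c d z v := by
  unfold bookCoord
  split_ifs <;> fun_prop

theorem bookCoord_nonneg (a b c d : V) {z : ℂ} (hz : z ∈ Metric.closedBall (0 : ℂ) 1) (v : V) :
    0 ≤ bookCoord a b c d z v := by
  have h : ‖z‖ ≤ 1 := by simpa using hz
  have h1 := abs_le.1 ((Complex.abs_re_le_norm z).trans h)
  have h2 := (Complex.abs_im_le_norm z).trans h
  unfold bookCoord
  split_ifs
  · linarith
  · linarith
  · positivity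
  · positivity
  · exact le_rfl

/-- Conjugation exchanges the two triangles, so the lower half disc is handled by the statements for
the upper one. -/
theorem bookCoord_swap (a b c d : V) (hcd : c ≠ d) (z : ℂ) :
    bookCoord a b c d z = bookCoord a b d c (starRingEnd ℂ z) := by
  funext v
  unfold bookCoord
  simp only [Complex.conj_im, Complex.conj_re, abs_neg, neg_neg]
  split_ifs <;> simp_all

open Classical in
theorem bookCoord_support (a b c d : V) {z : ℂ} (hz : 0 ≤ z.im) :
    Function.support (bookCoord a b c d z) ⊆ (({a, b, c} : Finset V) : Set V) := by
  intro v hv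
  by_contra h
  simp only [Finset.coe_insert, Finset.coe_singleton, Set.mem_insert_iff, Set.mem_singleton_iff,
    not_or] at h
  apply hv
  simp [bookCoord, h.1, h.2.1, h.2.2, max_eq_right (neg_nonpos.2 hz)]

open Classical in
theorem bookCoord_sum {a b c : V} (d : V) (hab : a ≠ b) (hac : a ≠ c) (hbc : b ≠ c) {z : ℂ}
    (hz : 0 ≤ z.im) : ∑ v ∈ ({a, b, c} : Finset V), bookCoord a b c d z v = 1 := by
  rw [Finset.sum_insert (by simp [hab, hac]), Finset.sum_pair hbc]
  simp only [bookCoord, if_true, if_neg hab.symm, if_neg hac.symm, if_neg hbc.symm,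
    abs_of_nonneg hz, max_eq_left hz]
  ring

open Classical in
theorem bookCoord_mem {a b c d : V} (hab : a ≠ b) (hac : a ≠ c) (hbc : b ≠ c) (had : a ≠ d)
    (hbd : b ≠ d) (hcd : c ≠ d) (h1 : ({a, b, c} : Finset V) ∈ K.faces)
    (h2 : ({a, b, d} : Finset V) ∈ K.faces) {z : ℂ} (hz : z ∈ Metric.closedBall (0 : ℂ) 1) :
    (∀ v, 0 ≤ bookCoord a b c d z v) ∧ ∃ s ∈ K.faces,
      Function.support (bookCoord a b c d z) ⊆ (s : Set V) ∧ ∑ v ∈ s, bookCoord a b c d z v = 1 := by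
  refine ⟨bookCoord_nonneg a b c d hz, ?_⟩
  rcases le_total 0 z.im with h | h
  · exact ⟨_, h1, bookCoord_support a b c d h, bookCoord_sum d hab hac hbc h⟩
  · have h' : 0 ≤ (starRingEnd ℂ z).im := by simpa using h
    rw [bookCoord_swap a b c d hcd]
    exact ⟨_, h2, bookCoord_support a b d c h', bookCoord_sum c hab had hbd h'⟩

open Classical in
/-- Two triangles with a common edge form a closed disc in the realization. -/
theorem exists_book {a b c d : V} (hab : a ≠ b) (hac : a ≠ c) (hbc : b ≠ c) (had : a ≠ d)
    (hbd : b ≠ d) (hcd : c ≠ d) (h1 : ({a, b, c} : Finset V) ∈ K.faces)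
    (h2 : ({a, b, d} : Finset V) ∈ K.faces) :
    ∃ φ : Metric.closedBall (0 : ℂ) 1 → Realization K, Continuous φ ∧
      ∀ z, (φ z).1 = bookCoord a b c d z := by
  let φ : Metric.closedBall (0 : ℂ) 1 → Realization K := fun z =>
    ⟨bookCoord a b c d z, bookCoord_mem hab hac hbc had hbd hcd h1 h2 z.2⟩
  refine ⟨φ, ?_, fun _ => rfl⟩
  rw [← continuousOn_univ]
  have hu : (Set.univ : Set ↥(Metric.closedBall (0 : ℂ) 1)) =
      {z : Metric.closedBall (0 : ℂ) 1 | 0 ≤ (z : ℂ).im} ∪ {z | (z : ℂ).im ≤ 0} :=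
    by
    ext z
    simp only [Set.mem_univ, Set.mem_union, Set.mem_ofPred_eq, true_iff]
    exact le_total 0 _
  rw [hu]
  refine ContinuousOn.union_of_isClosed ?_ ?_ (isClosed_le (by fun_prop) (by fun_prop))
    (isClosed_le (by fun_prop) (by fun_prop))
  · rw [continuousOn_iff_continuous_domRestrict]
    refine continuous_to_realization h1 (fun z => bookCoord_support a b c d z.2) fun v => ?_
    exact (continuous_bookCoord a b c d v).comp (by fun_prop)
  · rw [continuousOn_iff_continuous_domRestrict]
    refine continuous_to_realization h2 (fun z => ?_) fun v => ?_
    · have h' : 0 ≤ (starRingEnd ℂ (z : ℂ)).im := by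
        rw [Complex.conj_im]
        exact neg_nonneg.2 z.2
      change Function.support (bookCoord a b c d z) ⊆ _
      rw [bookCoord_swap a b c d hcd]
      exact bookCoord_support a b d c h'
    · exact (continuous_bookCoord a b c d v).comp (by fun_prop)

theorem bookCoord_injective {a b c d : V} (hab : a ≠ b) (hac : a ≠ c) (hbc : b ≠ c) (had : a ≠ d)
    (hbd : b ≠ d) (hcd : c ≠ d) : Function.Injective (bookCoord a b c d) := by
  intro z w h
  have ha := congrFun h a
  have hb := congrFun h b
  have hc := congrFun h c
  have hd := congrFun h d
  simp only [bookCoord, if_true, if_neg hab.symm, if_neg hac.symm, if_neg hbc.symm,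
    if_neg had.symm, if_neg hbd.symm, if_neg hcd.symm] at ha hb hc hd
  refine Complex.ext (by linarith) ?_
  have h1 := max_zero_sub_max_neg_zero_eq_self z.im
  have h2 := max_zero_sub_max_neg_zero_eq_self w.im
  linarith

open Classical in
/-- Three triangles with a common edge do not embed in the plane. -/
theorem not_three_triangles {D : Set ℂ} (Ψ : Realization K ≃ₜ D) {a b c d e : V} (hab : a ≠ b)
    (hac : a ≠ c) (hbc : b ≠ c) (had : a ≠ d) (hbd : b ≠ d) (hae : a ≠ e) (hbe : b ≠ e)
    (hcd : c ≠ d) (hce : c ≠ e) (hde : d ≠ e) (h1 : ({a, b, c} : Finset V) ∈ K.faces)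
    (h2 : ({a, b, d} : Finset V) ∈ K.faces) (h3 : ({a, b, e} : Finset V) ∈ K.faces) : False := by
  obtain ⟨φ, hφ, hφ'⟩ := exists_book hab hac hbc had hbd hcd h1 h2
  -- The second disc has the third triangle as its upper half; both discs are centred at the
  -- midpoint of the common edge.
  obtain ⟨ψ, hψ, hψ'⟩ := exists_book hab hae hbe hac hbc hce.symm h3 h1
  have h0 : φ ⟨0, by simp⟩ = ψ ⟨0, by simp⟩ := by
    apply Subtype.ext
    rw [hφ', hψ']
    funext v
    simp [bookCoord]
  have hn := range_mem_nhds_of_closedBall (fun z => (Ψ (φ z) : ℂ)) (by fun_prop) (by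
    intro z w h
    have h' : φ z = φ w := Ψ.injective (Subtype.ext h)
    have h'' := congrArg Subtype.val h'
    rw [hφ', hφ'] at h''
    exact Subtype.ext (bookCoord_injective hab hac hbc had hbd hcd h''))
  simp only [h0] at hn
  have hev : ∀ᶠ z in 𝓝 (⟨0, by simp⟩ : Metric.closedBall (0 : ℂ) 1),
      ((Ψ (ψ z) : D) : ℂ) ∈ Set.range fun z => (Ψ (φ z) : ℂ) :=
    (show Continuous fun z => ((Ψ (ψ z) : D) : ℂ) by fun_prop).continuousAt hn
  obtain ⟨r, hr, hball⟩ := Metric.eventually_nhds_iff.1 hev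
  -- A point of the third triangle this close to the midpoint must lie in the first disc, although
  -- its `e`-coordinate is positive. The minimum with 1 keeps the point in the unit disc.
  have hr' : 0 < min (r / 2) 1 := by positivity
  have hnorm : ‖((min (r / 2) 1 : ℝ) : ℂ) * Complex.I‖ = min (r / 2) 1 := by
    rw [norm_mul, Complex.norm_I, mul_one, Complex.norm_real, Real.norm_of_nonneg hr'.le]
  obtain ⟨z, hz⟩ := @hball ⟨((min (r / 2) 1 : ℝ) : ℂ) * Complex.I, by
      rw [mem_closedBall_zero_iff, hnorm]; exact min_le_right _ _⟩ (by
    rw [Subtype.dist_eq, dist_zero_right, hnorm]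
    exact (min_le_left _ _).trans_lt (by linarith))
  have h4 := congrArg (fun x : Realization K => x.1 e) (Ψ.injective (Subtype.ext hz))
  simp only [hφ', hψ'] at h4
  simp only [bookCoord, if_true, if_neg hae.symm, if_neg hbe.symm, if_neg hce.symm,
    if_neg hde.symm] at h4
  simp only [Complex.mul_im, Complex.ofReal_re, Complex.I_im, mul_one, Complex.ofReal_im,
    Complex.I_re, mul_zero, add_zero] at h4
  rw [max_eq_left hr'.le] at h4
  linarith

theorem exists_eq_triple {V : Type*} [DecidableEq V] {Δ : Finset V} (h3 : Δ.card = 3)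
    {v w : V} (hv : v ∈ Δ) (hw : w ∈ Δ) (hvw : v ≠ w) : ∃ u, v ≠ u ∧ w ≠ u ∧ Δ = {v, w, u} := by
  have h1 : ((Δ.erase v).erase w).card = 1 := by
    rw [Finset.card_erase_of_mem (Finset.mem_erase.2 ⟨hvw.symm, hw⟩),
      Finset.card_erase_of_mem hv, h3]
  obtain ⟨u, hu⟩ := Finset.card_eq_one.1 h1
  have hu' : u ∈ (Δ.erase v).erase w := by rw [hu]; simp
  simp only [Finset.mem_erase] at hu'
  refine ⟨u, hu'.2.1.symm, hu'.1.symm, ?_⟩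
  rw [← hu, Finset.insert_erase (Finset.mem_erase.2 ⟨hvw.symm, hw⟩), Finset.insert_erase hv]

/-- At most two triangles of a triangulated plane domain contain a given edge. -/
theorem card_triangles_le_two {D : Set ℂ} (hK : IsTriangulationOf K D) {a b : V} (hab : a ≠ b)
    (T : Finset (Finset V)) (hT : ∀ s ∈ T, s ∈ K.faces ∧ s.card = 3 ∧ a ∈ s ∧ b ∈ s) :
    T.card ≤ 2 := by
  classical
  obtain ⟨-, ⟨Ψ⟩⟩ := hK
  by_contra hcard
  obtain ⟨s, t, u, hs, ht, hu, hst, hsu, htu⟩ := Finset.two_lt_card_iff.1 (not_le.1 hcard)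
  have key : ∀ s ∈ T, ∃ c, a ≠ c ∧ b ≠ c ∧ s = {a, b, c} := by
    intro s hs
    obtain ⟨-, h3, ha, hb⟩ := hT s hs
    exact exists_eq_triple h3 ha hb hab
  obtain ⟨c, hac, hbc, rfl⟩ := key s hs
  obtain ⟨d, had, hbd, rfl⟩ := key t ht
  obtain ⟨e, hae, hbe, rfl⟩ := key u hu
  exact not_three_triangles Ψ hab hac hbc had hbd hae hbe (fun h => hst (by rw [h]))
    (fun h => hsu (by rw [h])) (fun h => htu (by rw [h])) (hT _ hs).1 (hT _ ht).1 (hT _ hu).1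

/-- Every edge of a triangulated plane domain is contained in a triangle. -/
theorem exists_triangle {D : Set ℂ} (hD : IsOpen D) (hK : IsTriangulationOf K D) {a b : V}
    (hab : (oneSkeleton K).Adj a b) : ∃ s ∈ K.faces, s.card = 3 ∧ a ∈ s ∧ b ∈ s := by
  classical
  obtain ⟨hdim, ⟨Ψ⟩⟩ := hK
  obtain ⟨hne, hface⟩ := hab
  by_contra hno
  push Not at hno
  have hpair : ∀ s ∈ K.faces, a ∈ s → b ∈ s → s = {a, b} := by
    intro s hs ha hb
    have hsub : ({a, b} : Finset V) ⊆ s := by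
      intro v hv
      simp only [Finset.mem_insert, Finset.mem_singleton] at hv
      rcases hv with rfl | rfl <;> assumption
    refine (Finset.eq_of_subset_of_card_le hsub ?_).symm
    rw [Finset.card_pair hne]
    have h1 := hdim s hs
    have h2 : s.card ≠ 3 := fun h => hno s hs h ha hb
    omega
  -- Without a triangle on the edge, `U` is the open edge itself, an open set on which the
  -- `a`-coordinate is injective.
  let U : Set (Realization K) := {x | 0 < x.1 a ∧ 0 < x.1 b}
  have hU : IsOpen U := (isOpen_lt continuous_const (continuous_coord a)).inter
    (isOpen_lt continuous_const (continuous_coord b))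
  have hUinj : ∀ x ∈ U, ∀ y ∈ U, x.1 a = y.1 a → x = y := by
    have hform : ∀ x ∈ U, x.1 b = 1 - x.1 a ∧ ∀ v, v ≠ a → v ≠ b → x.1 v = 0 := by
      intro x hx
      obtain ⟨s, hs, hmem, hsum⟩ := realization_support_mem x
      obtain rfl := hpair s hs ((hmem a).2 hx.1) ((hmem b).2 hx.2)
      rw [Finset.sum_pair hne] at hsum
      refine ⟨by linarith, fun v hva hvb => le_antisymm (not_lt.1 fun h => ?_) (x.2.1 v)⟩
      have := (hmem v).2 h
      simp [hva, hvb] at this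
    intro x hx y hy hxy
    obtain ⟨hx1, hx2⟩ := hform x hx
    obtain ⟨hy1, hy2⟩ := hform y hy
    apply Subtype.ext
    funext v
    by_cases hva : v = a
    · rw [hva, hxy]
    by_cases hvb : v = b
    · rw [hvb, hx1, hy1, hxy]
    rw [hx2 v hva hvb, hy2 v hva hvb]
  let m : Realization K := ⟨fun v => if v = a ∨ v = b then 1 / 2 else 0,
    fun v => by dsimp only; split_ifs <;> norm_num, {a, b}, hface, by
      intro v hv
      by_contra h
      simp only [Finset.coe_insert, Finset.coe_singleton, Set.mem_insert_iff,
        Set.mem_singleton_iff] at h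
      exact hv (if_neg h), by
      rw [Finset.sum_pair hne]; simp; norm_num⟩
  have hm : m ∈ U := by
    change (0 : ℝ) < (if a = a ∨ a = b then 1 / 2 else 0) ∧
      (0 : ℝ) < if b = a ∨ b = b then 1 / 2 else 0
    simp
  have hO : IsOpen (Subtype.val '' (Ψ '' U) : Set ℂ) :=
    hD.isOpenMap_subtype_val _ (Ψ.isOpenMap _ hU)
  obtain ⟨r, hr, hball⟩ := Metric.nhds_basis_closedBall.mem_iff.1
    (hO.mem_nhds ⟨Ψ m, ⟨m, hm, rfl⟩, rfl⟩)
  have hin : ∀ z : Metric.closedBall (0 : ℂ) 1,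
      (Ψ m : ℂ) + r * z ∈ (Subtype.val '' (Ψ '' U) : Set ℂ) := by
    intro z
    apply hball
    have := z.2
    rw [mem_closedBall_zero_iff] at this
    rw [mem_closedBall_iff_norm, add_sub_cancel_left, norm_mul, Complex.norm_real,
      Real.norm_of_nonneg hr.le]
    nlinarith
  have hinD : ∀ z : Metric.closedBall (0 : ℂ) 1, (Ψ m : ℂ) + r * z ∈ D := by
    intro z
    obtain ⟨y, -, hy⟩ := hin z
    rw [← hy]; exact y.2
  have hinU : ∀ z : Metric.closedBall (0 : ℂ) 1, Ψ.symm ⟨_, hinD z⟩ ∈ U := by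
    intro z
    obtain ⟨y, ⟨x, hx, rfl⟩, hy⟩ := hin z
    have : (⟨_, hinD z⟩ : D) = Ψ x := Subtype.ext hy.symm
    rw [this, Ψ.symm_apply_apply]
    exact hx
  -- This injects a disc into the real axis, which contains no neighbourhood of any of its points in
  -- the plane.
  let f : Metric.closedBall (0 : ℂ) 1 → ℂ := fun z => (((Ψ.symm ⟨_, hinD z⟩).1 a : ℝ) : ℂ)
  have hf : Continuous f := Complex.continuous_ofReal.comp ((continuous_coord a).comp
    (Ψ.symm.continuous.comp (Continuous.subtype_mk (by fun_prop) _)))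
  have hn := range_mem_nhds_of_closedBall f hf (by
    intro z w h
    have h1 := hUinj _ (hinU z) _ (hinU w) (Complex.ofReal_injective h)
    have h2 := congrArg Subtype.val (Ψ.symm.injective h1)
    apply Subtype.ext
    have hr0 : (r : ℂ) ≠ 0 := Complex.ofReal_ne_zero.2 hr.ne'
    exact mul_left_cancel₀ hr0 (add_left_cancel h2))
  obtain ⟨ε, hε, hε'⟩ := Metric.mem_nhds_iff.1 hn
  obtain ⟨z, hz⟩ := hε' (show f ⟨0, by simp⟩ + (ε / 2 : ℝ) * Complex.I ∈ Metric.ball _ ε by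
    rw [mem_ball_iff_norm, add_sub_cancel_left, norm_mul, Complex.norm_I, Complex.norm_real,
      Real.norm_of_nonneg (by positivity)]
    linarith)
  have := congrArg Complex.im hz
  simp [f] at this
  linarith

end EdgeTriangles

/-! ### Recurrent walks -/

section Recurrence

variable {V : Type*} {p : V → V → ℝ} {G : SimpleGraph V}

/-- A single path that visits every vertex enumerates them. -/
theorem IsRecurrentWalk.countable (h : IsRecurrentWalk p) : Countable V := by
  rcases isEmpty_or_nonempty V with _ | ⟨⟨a⟩⟩
  · infer_instance
  obtain ⟨μ, ⟨hμ, -⟩, hvisit⟩ := h a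
  obtain ⟨ω, hω⟩ := hvisit.exists
  exact Function.Surjective.countable (f := (ω : ℕ → V)) fun w => (hω w).exists

theorem IsWalkLaw.measureReal_cylinder_succ {a : V} {μ : Measure (PathSpace V)}
    (h : IsWalkLaw p a μ) (m : ℕ) (x : ℕ → V) (w : V) :
    μ.real {ω | ∀ i ≤ m + 1, ω i = Function.update x (m + 1) w i} =
      μ.real {ω | ∀ i ≤ m, ω i = x i} * p (x m) w := by
  rw [h.2, h.2, Finset.prod_range_succ, ← mul_assoc]
  have h1 : ∏ i ∈ Finset.range m,
      p (Function.update x (m + 1) w i) (Function.update x (m + 1) w (i + 1)) =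
      ∏ i ∈ Finset.range m, p (x i) (x (i + 1)) := by
    refine Finset.prod_congr rfl fun i hi => ?_
    rw [Finset.mem_range] at hi
    rw [Function.update_of_ne (by omega), Function.update_of_ne (by omega)]
  rw [h1, Function.update_self, Function.update_of_ne (by omega), Function.update_of_ne (by omega)]

theorem IsWalkLaw.exists_transition_ne_zero [Countable V] {a : V} {μ : Measure (PathSpace V)}
    (h : IsWalkLaw p a μ) : ∃ w, p a w ≠ 0 := by
  by_contra! hp
  have := h.1
  have h0 : μ.real {ω | ∀ i ≤ 0, ω i = a} = 1 := by simpa using h.2 0 fun _ => a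
  have h1 : μ (⋃ w, {ω | ∀ i ≤ 0 + 1, ω i = Function.update (fun _ => a) (0 + 1) w i}) = 0 := by
    rw [measure_iUnion_null_iff]
    intro w
    rw [← measureReal_eq_zero_iff, h.measureReal_cylinder_succ, hp, mul_zero]
  have h2 : {ω : PathSpace V | ∀ i ≤ 0, ω i = a} ⊆
      ⋃ w, {ω | ∀ i ≤ 0 + 1, ω i = Function.update (fun _ => a) (0 + 1) w i} := by
    intro ω hω
    refine Set.mem_iUnion.2 ⟨ω 1, fun i hi => ?_⟩
    obtain rfl | rfl : i = 0 ∨ i = 1 := by omega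
    · simpa using hω 0 le_rfl
    · simp
  have h3 := measure_mono_null h2 h1
  rw [← measureReal_eq_zero_iff] at h3
  linarith

theorem IsRecurrentGraph.neighborSet_finite (h : IsRecurrentGraph G) (v : V) :
    (G.neighborSet v).Finite := by
  have := IsRecurrentWalk.countable h
  obtain ⟨μ, hμ, -⟩ := h v
  obtain ⟨w, hw⟩ := hμ.exists_transition_ne_zero
  -- An infinite set has `ncard` 0, so at a vertex of infinite degree every transition would be `1 /
  -- 0 = 0`, which no walk law allows.
  refine Set.finite_of_ncard_ne_zero fun h0 => hw ?_
  simp [simpleTransition, h0]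

theorem IsWalkLaw.measure_start_ne [Countable V] {a : V} {μ : Measure (PathSpace V)}
    (h : IsWalkLaw p a μ) : μ {ω | ω 0 ≠ a} = 0 := by
  have := h.1
  have h1 : μ (⋃ w : {w // w ≠ a}, {ω | ∀ i ≤ 0, ω i = w}) = 0 := by
    rw [measure_iUnion_null_iff]
    rintro ⟨w, hw⟩
    rw [← measureReal_eq_zero_iff]
    simpa [hw] using h.2 0 fun _ => w
  refine measure_mono_null (fun ω hω => Set.mem_iUnion.2 ⟨⟨ω 0, hω⟩, fun i hi => ?_⟩) h1
  rw [Nat.le_zero.1 hi]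

/-- The transition operator of the simple random walk. -/
def average (G : SimpleGraph V) [G.LocallyFinite] (f : V → ℝ) (v : V) : ℝ :=
  (∑ w ∈ G.neighborFinset v, f w) / G.degree v

theorem simpleTransition_of_adj [G.LocallyFinite] {v w : V} (h : G.Adj v w) :
    simpleTransition G v w = 1 / (G.degree v : ℝ) := by
  rw [simpleTransition, if_pos h, Set.ncard_eq_toFinset_card', SimpleGraph.degree,
    SimpleGraph.neighborFinset]

/-- The probability of being at `y` after `n` steps from `v`. -/
def hitting (G : SimpleGraph V) [G.LocallyFinite] (y : V) (n : ℕ) : V → ℝ := by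
  classical exact (average G)^[n] (Pi.single y 1)

theorem hitting_succ [G.LocallyFinite] (y : V) (n : ℕ) :
    hitting G y (n + 1) = average G (hitting G y n) := by
  rw [hitting, Function.iterate_succ_apply', hitting]

theorem hitting_nonneg [G.LocallyFinite] (y : V) (n : ℕ) (v : V) : 0 ≤ hitting G y n v := by
  classical
  induction n generalizing v with
  | zero => by_cases h : v = y <;> simp [hitting, h]
  | succ n ih =>
    rw [hitting_succ, average]
    exact div_nonneg (Finset.sum_nonneg fun w _ => ih w) (Nat.cast_nonneg _)

theorem hitting_eq_zero [G.LocallyFinite] {y v : V} (h : ¬ G.Reachable v y) (n : ℕ) :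
    hitting G y n v = 0 := by
  classical
  induction n generalizing v with
  | zero =>
    have : v ≠ y := fun h' => h (h' ▸ .refl _)
    simp [hitting, this]
  | succ n ih =>
    rw [hitting_succ, average, Finset.sum_eq_zero, zero_div]
    intro w hw
    rw [SimpleGraph.mem_neighborFinset] at hw
    exact ih fun h' => h (hw.reachable.trans h')

theorem hitting_support_finite [G.LocallyFinite] (y : V) (n : ℕ) :
    (Function.support (hitting G y n)).Finite := by
  classical
  induction n with
  | zero =>
    refine (Set.finite_singleton y).subset fun v hv => ?_
    by_contra h
    exact hv (by simp [hitting, show v ≠ y from h])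
  | succ n ih =>
    refine (ih.biUnion fun w _ => (G.neighborFinset w).finite_toSet).subset fun v hv => ?_
    rw [hitting_succ] at hv
    obtain ⟨w, hw, hw'⟩ : ∃ w ∈ G.neighborFinset v, hitting G y n w ≠ 0 := by
      by_contra! h
      exact hv (by rw [average, Finset.sum_eq_zero h, zero_div])
    rw [SimpleGraph.mem_neighborFinset] at hw
    exact Set.mem_biUnion (x := w) hw' (by simpa using hw.symm)

/-- Induction on `n`, splitting by the next vertex; cylinders that step to a non-neighbour are null.
An upper bound suffices later and needs only subadditivity, hence no measurability. -/
theorem IsWalkLaw.measureReal_cylinder_inter_le [Countable V] [G.LocallyFinite] {a : V}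
    {μ : Measure (PathSpace V)} (h : IsWalkLaw (simpleTransition G) a μ) (y : V) (n m : ℕ)
    (x : ℕ → V) :
    μ.real {ω | (∀ i ≤ m, ω i = x i) ∧ ω (m + n) = y} ≤
      μ.real {ω | ∀ i ≤ m, ω i = x i} * hitting G y n (x m) := by
  classical
  have := h.1
  induction n generalizing m x with
  | zero =>
    by_cases hy : x m = y
    · rw [hitting, Function.iterate_zero, id, hy, Pi.single_eq_same, mul_one]
      exact measureReal_mono fun ω hω => hω.1
    · have : {ω : PathSpace V | (∀ i ≤ m, ω i = x i) ∧ ω (m + 0) = y} = ∅ := by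
        ext ω
        simp only [Set.mem_ofPred_eq, Set.mem_empty_iff_false, iff_false, not_and]
        exact fun h1 h2 => hy ((h1 m le_rfl).symm.trans h2)
      rw [this, measureReal_empty]
      exact mul_nonneg measureReal_nonneg (hitting_nonneg y 0 _)
  | succ n ih =>
    let A : V → Set (PathSpace V) := fun w =>
      {ω | ∀ i ≤ m + 1, ω i = Function.update x (m + 1) w i}
    let B : V → Set (PathSpace V) := fun w =>
      {ω | (∀ i ≤ m + 1, ω i = Function.update x (m + 1) w i) ∧ ω (m + 1 + n) = y}
    have hnull : μ.real (⋃ w : {w // ¬ G.Adj (x m) w}, A w) = 0 := by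
      rw [measureReal_eq_zero_iff, measure_iUnion_null_iff]
      rintro ⟨w, hw⟩
      rw [← measureReal_eq_zero_iff, h.measureReal_cylinder_succ, simpleTransition, if_neg hw,
        mul_zero]
    have hsub : {ω : PathSpace V | (∀ i ≤ m, ω i = x i) ∧ ω (m + (n + 1)) = y} ⊆
        (⋃ w ∈ G.neighborFinset (x m), B w) ∪ ⋃ w : {w // ¬ G.Adj (x m) w}, A w := by
      rintro ω ⟨h1, h2⟩
      have hA : ∀ i ≤ m + 1, ω i = Function.update x (m + 1) (ω (m + 1)) i := by
        intro i hi
        rcases Nat.lt_or_ge m i with h3 | h3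
        · obtain rfl : i = m + 1 := by omega
          rw [Function.update_self]
        · rw [Function.update_of_ne (by omega)]
          exact h1 i h3
      by_cases hadj : G.Adj (x m) (ω (m + 1))
      · left
        exact Set.mem_biUnion (x := ω (m + 1)) (by simpa using hadj)
          ⟨hA, by rw [show m + 1 + n = m + (n + 1) by omega]; exact h2⟩
      · right
        exact Set.mem_iUnion.2 ⟨⟨ω (m + 1), hadj⟩, hA⟩
    calc _ ≤ μ.real ((⋃ w ∈ G.neighborFinset (x m), B w) ∪
            ⋃ w : {w // ¬ G.Adj (x m) w}, A w) := measureReal_mono hsub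
      _ ≤ μ.real (⋃ w ∈ G.neighborFinset (x m), B w) + 0 := by
        rw [← hnull]
        exact measureReal_union_le _ _
      _ ≤ ∑ w ∈ G.neighborFinset (x m), μ.real (B w) := by
        rw [add_zero]
        exact measureReal_biUnion_finset_le _ _
      _ ≤ ∑ w ∈ G.neighborFinset (x m),
          μ.real {ω | ∀ i ≤ m, ω i = x i} * (1 / (G.degree (x m) : ℝ)) * hitting G y n w := by
        refine Finset.sum_le_sum fun w hw => ?_
        rw [SimpleGraph.mem_neighborFinset] at hw
        refine (ih (m + 1) (Function.update x (m + 1) w)).trans_eq ?_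
        rw [h.measureReal_cylinder_succ, simpleTransition_of_adj hw, Function.update_self]
      _ = _ := by
        rw [hitting_succ, average, ← Finset.mul_sum]
        ring

theorem IsWalkLaw.measureReal_le_hitting [Countable V] [G.LocallyFinite] {a : V}
    {μ : Measure (PathSpace V)} (h : IsWalkLaw (simpleTransition G) a μ) (y : V) (n : ℕ) :
    μ.real {ω | ω n = y} ≤ hitting G y n a := by
  have := h.1
  have hsub : {ω : PathSpace V | ω n = y} ⊆
      {ω | (∀ i ≤ 0, ω i = a) ∧ ω (0 + n) = y} ∪ {ω | ω 0 ≠ a} := by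
    intro ω hω
    by_cases h0 : ω 0 = a
    · left
      refine ⟨fun i hi => ?_, by rw [zero_add]; exact hω⟩
      rw [Nat.le_zero.1 hi, h0]
    · exact Or.inr h0
  have h0 : μ.real {ω : PathSpace V | ω 0 ≠ a} = 0 := by
    rw [measureReal_eq_zero_iff]; exact h.measure_start_ne
  calc _ ≤ _ := measureReal_mono hsub
    _ ≤ _ := measureReal_union_le _ _
    _ ≤ μ.real {ω : PathSpace V | ∀ i ≤ 0, ω i = a} * hitting G y n a + 0 :=
      add_le_add (h.measureReal_cylinder_inter_le y n 0 fun _ => a) h0.le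
    _ ≤ hitting G y n a := by
      rw [add_zero]
      exact mul_le_of_le_one_left (hitting_nonneg _ _ _) measureReal_le_one

theorem IsRecurrentGraph.reachable (h : IsRecurrentGraph G) (a v : V) : G.Reachable a v := by
  have := IsRecurrentWalk.countable h
  have : G.LocallyFinite := fun v => (h.neighborSet_finite v).fintype
  by_contra hr
  obtain ⟨μ, hμ, hvisit⟩ := h a
  have := hμ.1
  have h0 : μ (⋃ n, {ω : PathSpace V | ω n = v}) = 0 := by
    rw [measure_iUnion_null_iff]
    intro n
    rw [← measureReal_eq_zero_iff]
    exact le_antisymm ((hμ.measureReal_le_hitting v n).trans_eq (hitting_eq_zero hr n))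
      measureReal_nonneg
  have h1 : ∀ᵐ ω ∂μ, ω ∉ ⋃ n, {ω : PathSpace V | ω n = v} := measure_eq_zero_iff_ae_notMem.1 h0
  obtain ⟨ω, hω, hω'⟩ := (hvisit.and h1).exists
  exact hω' (Set.mem_iUnion.2 (hω v).exists)

/-- By Borel–Cantelli, summability would make infinitely many returns to `a` a null event. -/
theorem IsRecurrentGraph.not_summable_hitting (h : IsRecurrentGraph G) [G.LocallyFinite] (a : V) :
    ¬ Summable fun n => hitting G a n a := by
  intro hs
  have := IsRecurrentWalk.countable h
  obtain ⟨μ, hμ, hvisit⟩ := h a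
  have := hμ.1
  have h1 : ∑' n, μ {ω : PathSpace V | ω n = a} ≠ ⊤ := by
    refine ne_top_of_le_ne_top hs.tsum_ofReal_ne_top (ENNReal.tsum_le_tsum fun n => ?_)
    rw [← ofReal_measureReal]
    exact ENNReal.ofReal_le_ofReal (hμ.measureReal_le_hitting a n)
  have h2 := measure_setOfPred_frequently_eq_zero h1
  have h3 : ∀ᵐ ω ∂μ, ω ∉ {ω : PathSpace V | ∃ᶠ n in atTop, ω n = a} :=
    measure_eq_zero_iff_ae_notMem.1 h2
  obtain ⟨ω, hω, hω'⟩ := (hvisit.and h3).exists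
  exact hω' (hω a)

/-! ### Electrical networks -/

/-- Discrete Green identity: exchange the summation indices and use the symmetry of `c`. -/
theorem sum_mul_sub_mul_sub (c : V → V → ℝ) (hc : ∀ v w, c v w = c w v) (f k : V → ℝ)
    (S : Finset V) : ∑ v ∈ S, ∑ w ∈ S, c v w * ((f v - f w) * (k v - k w)) =
      2 * ∑ v ∈ S, f v * ∑ w ∈ S, c v w * (k v - k w) := by
  have h1 : ∑ v ∈ S, ∑ w ∈ S, c v w * (f w * (k v - k w)) =
      - ∑ v ∈ S, f v * ∑ w ∈ S, c v w * (k v - k w) := by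
    rw [Finset.sum_comm, ← Finset.sum_neg_distrib]
    refine Finset.sum_congr rfl fun w _ => ?_
    rw [Finset.mul_sum, ← Finset.sum_neg_distrib]
    refine Finset.sum_congr rfl fun v _ => ?_
    rw [hc v w]; ring
  have h2 : ∑ v ∈ S, ∑ w ∈ S, c v w * ((f v - f w) * (k v - k w)) =
      ∑ v ∈ S, f v * ∑ w ∈ S, c v w * (k v - k w) -
        ∑ v ∈ S, ∑ w ∈ S, c v w * (f w * (k v - k w)) := by
    rw [← Finset.sum_sub_distrib]
    refine Finset.sum_congr rfl fun v _ => ?_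
    rw [Finset.mul_sum, ← Finset.sum_sub_distrib]
    exact Finset.sum_congr rfl fun w _ => by ring
  rw [h2, h1]; ring

/-- A conductance function on the edges of `G` that is at most `1`. -/
structure IsConductance (G : SimpleGraph V) (c : V → V → ℝ) : Prop where
  symm : ∀ v w, c v w = c w v
  pos : ∀ v w, G.Adj v w → 0 < c v w
  le_one : ∀ v w, G.Adj v w → c v w ≤ 1
  eq_zero : ∀ v w, ¬ G.Adj v w → c v w = 0

theorem IsConductance.nonneg {c : V → V → ℝ} (hc : IsConductance G c) (v w : V) : 0 ≤ c v w := by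
  by_cases h : G.Adj v w
  · exact (hc.pos v w h).le
  · exact (hc.eq_zero v w h).ge

open Classical in
/-- The conductance function that equals `1` on every edge. -/
def unitConductance (G : SimpleGraph V) (v w : V) : ℝ := if G.Adj v w then 1 else 0

theorem isConductance_unit (G : SimpleGraph V) : IsConductance G (unitConductance G) where
  symm v w := by rw [unitConductance, unitConductance, G.adj_comm]
  pos v w h := by simp [unitConductance, h]
  le_one v w h := by simp [unitConductance, h]
  eq_zero v w h := by simp [unitConductance, h]

/-- Twice the Dirichlet energy of `f` over the edges in `S`. -/
def energy (c : V → V → ℝ) (S : Finset V) (f : V → ℝ) : ℝ :=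
  ∑ v ∈ S, ∑ w ∈ S, c v w * (f v - f w) ^ 2

theorem energy_mono {c : V → V → ℝ} (hc : IsConductance G c) {S T : Finset V} (h : S ⊆ T)
    (f : V → ℝ) : energy c S f ≤ energy c T f := by
  have h0 : ∀ v w, 0 ≤ c v w * (f v - f w) ^ 2 := fun v w =>
    mul_nonneg (hc.nonneg v w) (sq_nonneg _)
  calc energy c S f ≤ ∑ v ∈ S, ∑ w ∈ T, c v w * (f v - f w) ^ 2 :=
        Finset.sum_le_sum fun v _ => Finset.sum_le_sum_of_subset_of_nonneg h fun w _ _ => h0 v w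
    _ ≤ energy c T f := Finset.sum_le_sum_of_subset_of_nonneg h fun v _ _ =>
        Finset.sum_nonneg fun w _ => h0 v w

theorem le_energy {c : V → V → ℝ} (hc : IsConductance G c) {S : Finset V} {v w : V} (hv : v ∈ S)
    (hw : w ∈ S) (f : V → ℝ) : c v w * (f v - f w) ^ 2 ≤ energy c S f := by
  have h0 : ∀ v w, 0 ≤ c v w * (f v - f w) ^ 2 := fun v w =>
    mul_nonneg (hc.nonneg v w) (sq_nonneg _)
  exact (Finset.single_le_sum (f := fun w => c v w * (f v - f w) ^ 2) (fun w _ => h0 v w) hw).trans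
    (Finset.single_le_sum (f := fun v => ∑ w ∈ S, c v w * (f v - f w) ^ 2)
      (fun v _ => Finset.sum_nonneg fun w _ => h0 v w) hv)

theorem IsConductance.sum_eq [G.LocallyFinite] {c : V → V → ℝ} (hc : IsConductance G c)
    {S : Finset V} {v : V} (h : G.neighborFinset v ⊆ S) (k : V → ℝ) :
    ∑ w ∈ S, c v w * k w = ∑ w ∈ G.neighborFinset v, c v w * k w := by
  refine (Finset.sum_subset h fun w _ hw => ?_).symm
  rw [SimpleGraph.mem_neighborFinset] at hw
  rw [hc.eq_zero v w hw, zero_mul]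

open Classical in
/-- A finite set and all its neighbours. -/
def closedNeighborhood (G : SimpleGraph V) [G.LocallyFinite] (T : Finset V) : Finset V :=
  T ∪ T.biUnion fun v => G.neighborFinset v

theorem neighborFinset_subset_closedNeighborhood [G.LocallyFinite] {T : Finset V} {v : V}
    (hv : v ∈ T) : G.neighborFinset v ⊆ closedNeighborhood G T := by
  classical
  exact (Finset.subset_biUnion_of_mem (fun v => G.neighborFinset v) hv).trans
    Finset.subset_union_right

/-- The vertices of a recurrent graph have zero capacity. -/
theorem IsRecurrentGraph.exists_energy_le (h : IsRecurrentGraph G) (a : V) {ε : ℝ} (hε : 0 < ε) :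
    ∃ f : V → ℝ, (Function.support f).Finite ∧ f a = 1 ∧
      ∀ S, energy (unitConductance G) S f ≤ ε := by
  classical
  have : G.LocallyFinite := fun v => (h.neighborSet_finite v).fintype
  have htend := (not_summable_iff_tendsto_nat_atTop_of_nonneg
    (fun n => hitting_nonneg (G := G) a n a)).1 (h.not_summable_hitting a)
  obtain ⟨N, hN1, hN2⟩ := ((htend.eventually_ge_atTop (2 * G.degree a / ε)).and
    (htend.eventually_gt_atTop 0)).exists
  -- The truncated Green function with pole `a`. Its energy will be at most `2 * g a * deg a`, so `g
  -- / g a` has energy at most `2 * deg a / g a`; this is why `N` was chosen with `g a ≥ 2 * deg a /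
  -- ε`.
  let g : V → ℝ := fun v => ∑ n ∈ Finset.range N, hitting G a n v
  have hg0 : ∀ v, 0 ≤ g v := fun v => Finset.sum_nonneg fun n _ => hitting_nonneg a n v
  have hgfin : (Function.support g).Finite := by
    refine ((Finset.range N).finite_toSet.biUnion
      fun n _ => hitting_support_finite (G := G) a n).subset fun v hv => ?_
    obtain ⟨n, hn, hn'⟩ := Finset.exists_ne_zero_of_sum_ne_zero hv
    exact Set.mem_biUnion (x := n) hn hn'
  -- The sum telescopes: `average G g` is `g` minus the point mass at `a` plus the nonnegative term
  -- `hitting G a N`.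
  have hgavg : ∀ v, average G g v ≥ g v - Pi.single (M := fun _ => ℝ) a 1 v := by
    intro v
    have h1 : average G g v = ∑ n ∈ Finset.range N, hitting G a (n + 1) v := by
      simp only [hitting_succ, average, g, ← Finset.sum_div]
      rw [Finset.sum_comm]
    have h2 : ∑ n ∈ Finset.range N, hitting G a (n + 1) v + hitting G a 0 v =
        g v + hitting G a N v := by
      rw [← Finset.sum_range_succ' (fun n => hitting G a n v),
        Finset.sum_range_succ (fun n => hitting G a n v)]
    have h3 : hitting G a 0 v = Pi.single (M := fun _ => ℝ) a 1 v := rfl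
    have h4 := hitting_nonneg (G := G) a N v
    rw [h1]
    linarith
  have henergy : ∀ S, energy (unitConductance G) S g ≤ 2 * (g a * G.degree a) := by
    intro S
    let T := hgfin.toFinset
    -- Enlarging `S` makes the inner sums at points of the support full Laplacians.
    let S' := S ∪ closedNeighborhood G T
    refine (energy_mono (isConductance_unit G) (Finset.subset_union_left : S ⊆ S') g).trans ?_
    have h1 := sum_mul_sub_mul_sub _ (isConductance_unit G).symm g g S'
    simp only [← pow_two] at h1
    rw [energy, h1]
    refine mul_le_mul_of_nonneg_left ?_ two_pos.le
    have h2 : ∀ v ∈ S', g v * ∑ w ∈ S', unitConductance G v w * (g v - g w) ≤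
        if v = a then g a * G.degree a else 0 := by
      intro v _
      by_cases hv : g v = 0
      · rw [hv, zero_mul]
        split_ifs
        · exact mul_nonneg (hg0 a) (Nat.cast_nonneg _)
        · exact le_rfl
      have hvT : v ∈ T := by simpa [T] using hv
      rw [(isConductance_unit G).sum_eq ((neighborFinset_subset_closedNeighborhood hvT).trans
        Finset.subset_union_right)]
      have h3 : ∑ w ∈ G.neighborFinset v, unitConductance G v w * (g v - g w) =
          G.degree v * g v - ∑ w ∈ G.neighborFinset v, g w := by
        rw [← nsmul_eq_mul, SimpleGraph.degree, ← Finset.sum_const, ← Finset.sum_sub_distrib]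
        refine Finset.sum_congr rfl fun w hw => ?_
        rw [SimpleGraph.mem_neighborFinset] at hw
        simp [unitConductance, hw]
      have h4 : G.degree v * average G g v = ∑ w ∈ G.neighborFinset v, g w := by
        by_cases hd : (G.degree v : ℝ) = 0
        · have : G.neighborFinset v = ∅ := Finset.card_eq_zero.1 (by exact_mod_cast hd)
          rw [hd, zero_mul, this, Finset.sum_empty]
        · rw [average, mul_div_cancel₀ _ hd]
      have h5 := mul_le_mul_of_nonneg_left (hgavg v) (Nat.cast_nonneg (α := ℝ) (G.degree v))
      rw [h3, ← h4]
      split_ifs with hva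
      · subst hva
        refine mul_le_mul_of_nonneg_left ?_ (hg0 v)
        rw [Pi.single_eq_same] at h5
        linarith
      · rw [Pi.single_eq_of_ne hva] at h5
        exact mul_nonpos_of_nonneg_of_nonpos (hg0 v) (by linarith)
    refine (Finset.sum_le_sum h2).trans ?_
    rw [Finset.sum_ite_eq']
    split_ifs
    · exact le_rfl
    · exact mul_nonneg (hg0 a) (Nat.cast_nonneg _)
  have hga : 0 < g a := hN2
  refine ⟨fun v => g v / g a, hgfin.subset fun v hv hv' => hv (by simp [hv']), div_self hga.ne', ?_⟩
  intro S
  have h1 : energy (unitConductance G) S (fun v => g v / g a) =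
      energy (unitConductance G) S g / g a ^ 2 := by
    simp only [energy, Finset.sum_div]
    refine Finset.sum_congr rfl fun v _ => Finset.sum_congr rfl fun w _ => ?_
    field_simp
  rw [h1, div_le_iff₀ (by positivity)]
  refine (henergy S).trans ?_
  have h2 : 2 * G.degree a ≤ g a * ε := (div_le_iff₀ hε).1 hN1
  nlinarith

/-- Superharmonicity is tested against `f ^ 2 / g`. The pointwise identity `hid` splits the energy
of `f` into the displayed squares and a remainder that summation by parts shows to be nonnegative;
`c ≤ 1` then compares with unit conductances. -/
theorem superharmonic_sq_le_energy [G.LocallyFinite] {c : V → V → ℝ} (hc : IsConductance G c)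
    {g : V → ℝ} (hg : ∀ v, 0 < g v)
    (hsuper : ∀ v, 0 ≤ ∑ w ∈ G.neighborFinset v, c v w * (g v - g w)) {f : V → ℝ}
    (hf : (Function.support f).Finite) {ε : ℝ} (hε : ∀ S, energy (unitConductance G) S f ≤ ε)
    (u v : V) : c u v * (g u * g v * (f u / g u - f v / g v) ^ 2) ≤ ε := by
  classical
  let S := {u, v} ∪ closedNeighborhood G hf.toFinset
  let φ : V → ℝ := fun v => f v ^ 2 / g v
  have hid : ∀ v w, (f v - f w) ^ 2 - (φ v - φ w) * (g v - g w) =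
      g v * g w * (f v / g v - f w / g w) ^ 2 := by
    intro v w
    have h1 := (hg v).ne'
    have h2 := (hg w).ne'
    simp only [φ]
    field_simp
    ring
  have h0 : ∀ v w, 0 ≤ c v w * (g v * g w * (f v / g v - f w / g w) ^ 2) := fun v w =>
    mul_nonneg (hc.nonneg v w) (mul_nonneg (mul_pos (hg v) (hg w)).le (sq_nonneg _))
  have hφ : 0 ≤ ∑ v ∈ S, ∑ w ∈ S, c v w * ((φ v - φ w) * (g v - g w)) := by
    rw [sum_mul_sub_mul_sub c hc.symm]
    refine mul_nonneg two_pos.le (Finset.sum_nonneg fun v _ => ?_)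
    by_cases hv : f v = 0
    · simp [φ, hv]
    · refine mul_nonneg (div_nonneg (sq_nonneg _) (hg v).le) ?_
      rw [hc.sum_eq ((neighborFinset_subset_closedNeighborhood
        (show v ∈ hf.toFinset by simpa using hv)).trans Finset.subset_union_right)]
      exact hsuper v
  calc _ ≤ ∑ w ∈ S, c u w * (g u * g w * (f u / g u - f w / g w) ^ 2) :=
        Finset.single_le_sum (f := fun w => c u w * (g u * g w * (f u / g u - f w / g w) ^ 2))
          (fun w _ => h0 u w) (by simp [S])
    _ ≤ ∑ v ∈ S, ∑ w ∈ S, c v w * (g v * g w * (f v / g v - f w / g w) ^ 2) :=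
        Finset.single_le_sum
          (f := fun v => ∑ w ∈ S, c v w * (g v * g w * (f v / g v - f w / g w) ^ 2))
          (fun v _ => Finset.sum_nonneg fun w _ => h0 v w) (by simp [S])
    _ = ∑ v ∈ S, ∑ w ∈ S, c v w * (f v - f w) ^ 2 -
          ∑ v ∈ S, ∑ w ∈ S, c v w * ((φ v - φ w) * (g v - g w)) := by
        simp only [← Finset.sum_sub_distrib, ← mul_sub, hid]
    _ ≤ ∑ v ∈ S, ∑ w ∈ S, c v w * (f v - f w) ^ 2 := by linarith
    _ ≤ energy (unitConductance G) S f := by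
        refine Finset.sum_le_sum fun v _ => Finset.sum_le_sum fun w _ =>
          mul_le_mul_of_nonneg_right ?_ (sq_nonneg _)
        by_cases h : G.Adj v w
        · simpa [unitConductance, h] using hc.le_one v w h
        · simp [unitConductance, h, hc.eq_zero v w h]
    _ ≤ ε := hε S

/-- Positive superharmonic functions on a network with bounded conductances on a recurrent graph
are constant. -/
theorem IsRecurrentGraph.superharmonic_const (h : IsRecurrentGraph G) [G.LocallyFinite]
    {c : V → V → ℝ} (hc : IsConductance G c) {g : V → ℝ} (hg : ∀ v, 0 < g v)
    (hsuper : ∀ v, 0 ≤ ∑ w ∈ G.neighborFinset v, c v w * (g v - g w)) (a v : V) : g v = g a := by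
  choose f hfin hfa hE using fun n : ℕ =>
    h.exists_energy_le a (Nat.one_div_pos_of_nat (α := ℝ) (n := n))
  have hlim := tendsto_one_div_add_atTop_nhds_zero_nat (𝕜 := ℝ)
  have hstep : ∀ u v, G.Adj u v → Tendsto (fun n => f n u) atTop (𝓝 1) →
      Tendsto (fun n => f n v) atTop (𝓝 1) := by
    classical
    intro u v huv hu
    have h1 : Tendsto (fun n => (f n u - f n v) ^ 2) atTop (𝓝 0) := by
      refine squeeze_zero (fun n => sq_nonneg _) (fun n => ?_) hlim
      have := (le_energy (isConductance_unit G) (S := {u, v}) (v := u) (w := v) (by simp)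
        (by simp) (f n)).trans
        (hE n {u, v})
      simpa [unitConductance, huv] using this
    have h2 : Tendsto (fun n => f n u - f n v) atTop (𝓝 0) := by
      rw [tendsto_zero_iff_abs_tendsto_zero]
      have := h1.sqrt
      simpa [Real.sqrt_sq_eq_abs, Function.comp_def] using this
    simpa using hu.sub h2
  -- The energy bounds the increment along each edge, so by connectedness the limit 1 spreads from
  -- `a` to every vertex.
  have hone : ∀ v, Tendsto (fun n => f n v) atTop (𝓝 1) := by
    intro v
    obtain ⟨p⟩ := (h.reachable a v).symm
    induction p with
    | nil => simp [hfa]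
    | cons hadj _ ih => exact hstep _ _ hadj.symm (ih hfa)
  have hedge : ∀ u v, G.Adj u v → g u = g v := by
    intro u v huv
    have h1 : Tendsto (fun n => c u v * (g u * g v * (f n u / g u - f n v / g v) ^ 2)) atTop
        (𝓝 (c u v * (g u * g v * (1 / g u - 1 / g v) ^ 2))) :=
      ((((hone u).div_const _).sub ((hone v).div_const _)).pow 2).const_mul _ |>.const_mul _
    -- In the limit `f n → 1` only the difference of `1 / g u` and `1 / g v` remains, and its
    -- weighted square is at most 0.
    have h2 := le_of_tendsto_of_tendsto' h1 hlim fun n =>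
      superharmonic_sq_le_energy hc hg hsuper (hfin n) (hE n) u v
    have h3 : 0 < c u v * (g u * g v) := mul_pos (hc.pos u v huv) (mul_pos (hg u) (hg v))
    rw [← mul_assoc] at h2
    have h4 : (1 / g u - 1 / g v) ^ 2 = 0 :=
      le_antisymm (nonpos_of_mul_nonpos_right h2 h3) (sq_nonneg _)
    have h5 := sub_eq_zero.1 (pow_eq_zero_iff two_ne_zero |>.1 h4)
    rwa [one_div, one_div, inv_inj] at h5
  obtain ⟨p⟩ := (h.reachable a v).symm
  induction p with
  | nil => rfl
  | cons hadj _ ih => exact (hedge _ _ hadj).trans (ih hfa)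

end Recurrence

/-! ### Variation of angles -/

section Angles

/-- The derivative of the angle at the circle of radius `a` along a deformation of three mutually
tangent circles with logarithmic derivatives `h`. -/
theorem hasDerivAt_arccos_angle {a b c : ℝ → ℝ} {ha hb hc t : ℝ} (ha0 : 0 < a t) (hb0 : 0 < b t)
    (hc0 : 0 < c t) (hda : HasDerivAt a (a t * ha) t) (hdb : HasDerivAt b (b t * hb) t)
    (hdc : HasDerivAt c (c t * hc) t) :
    HasDerivAt (fun s => Real.arccos (((a s + b s) ^ 2 + (a s + c s) ^ 2 - (b s + c s) ^ 2) /
        (2 * ((a s + b s) * (a s + c s)))))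
      (√(a t * b t * c t / (a t + b t + c t)) / (a t + b t) * (hb - ha) +
        √(a t * b t * c t / (a t + b t + c t)) / (a t + c t) * (hc - ha)) t := by
  have hab : 0 < a t + b t := by positivity
  have hac : 0 < a t + c t := by positivity
  set X : ℝ := ((a t + b t) ^ 2 + (a t + c t) ^ 2 - (b t + c t) ^ 2) /
        (2 * ((a t + b t) * (a t + c t))) with hX
  -- The two forms give `-1 < X < 1`, where `arccos` is differentiable, and factor `1 - X ^ 2`, the
  -- squared sine of the angle.
  have hX1 : X = 1 - 2 * (b t * c t) / ((a t + b t) * (a t + c t)) := by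
    rw [hX]; field_simp; ring
  have hX2 : X = -1 + 2 * (a t * (a t + b t + c t)) / ((a t + b t) * (a t + c t)) := by
    rw [hX]; field_simp; ring
  have hXlt : X < 1 := by
    rw [hX1]
    have : 0 < 2 * (b t * c t) / ((a t + b t) * (a t + c t)) := by positivity
    linarith
  have hXgt : -1 < X := by
    rw [hX2]
    have : 0 < 2 * (a t * (a t + b t + c t)) / ((a t + b t) * (a t + c t)) := by positivity
    linarith
  have hsum : 0 < a t + b t + c t := by positivity
  -- By Heron's formula this is the inradius: the sides are sums of two radii and the semiperimeter
  -- is `a + b + c`.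
  set R := √(a t * b t * c t / (a t + b t + c t)) with hR
  have hRpos : 0 < R := Real.sqrt_pos.2 (by positivity)
  have hR2 : R * R = a t * b t * c t / (a t + b t + c t) := Real.mul_self_sqrt (by positivity)
  have hsqrt : √(1 - X ^ 2) = 2 * (a t + b t + c t) * R / ((a t + b t) * (a t + c t)) := by
    rw [Real.sqrt_eq_iff_mul_self_eq (by nlinarith) (by positivity)]
    calc 1 - X ^ 2 = (1 - X) * (1 + X) := by ring
      _ = 4 * (a t + b t + c t) ^ 2 * (a t * b t * c t / (a t + b t + c t)) /
          ((a t + b t) * (a t + c t)) ^ 2 := by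
        nth_rewrite 1 [hX1]
        rw [hX2]
        field_simp
        ring
      _ = _ := by
        rw [← hR2]
        field_simp
        ring
  have hd := (Real.hasDerivAt_arccos (x := X) hXgt.ne' hXlt.ne).comp t
    (((((hda.add hdb).pow 2).add ((hda.add hdc).pow 2)).sub ((hdb.add hdc).pow 2)).div
      (((hda.add hdb).mul (hda.add hdc)).const_mul 2)
      (mul_ne_zero two_ne_zero (mul_ne_zero hab.ne' hac.ne')))
  refine hd.congr_deriv ?_
  simp only [Pi.add_apply, Pi.sub_apply, Pi.mul_apply, Pi.pow_apply, hsqrt]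
  have hRne := hRpos.ne'
  have hsne := hsum.ne'
  have habne := hab.ne'
  have hacne := hac.ne'
  have hR3 : R ^ 2 * (a t + b t + c t) = a t * b t * c t := by
    rw [pow_two, hR2]
    field_simp
  clear_value R
  field_simp
  rw [show 2 - 1 = 1 from rfl, Nat.cast_two]
  linear_combination
    (-4 * ((a t + c t) * (hb - ha) + (a t + b t) * (hc - ha))) * hR3

variable {V : Type*}

/-- The geometric interpolation between two labels. -/
def interpolate (ρ ρ' : V → ℝ) (v : V) (t : ℝ) : ℝ := ρ v * Real.exp (t * Real.log (ρ' v / ρ v))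

theorem interpolate_pos {ρ : V → ℝ} (hρ : IsLabel ρ) (ρ' : V → ℝ) (v : V) (t : ℝ) :
    0 < interpolate ρ ρ' v t := mul_pos (hρ v) (Real.exp_pos _)

theorem interpolate_zero (ρ ρ' : V → ℝ) (v : V) : interpolate ρ ρ' v 0 = ρ v := by
  simp [interpolate]

theorem interpolate_one {ρ ρ' : V → ℝ} (hρ : IsLabel ρ) (hρ' : IsLabel ρ') (v : V) :
    interpolate ρ ρ' v 1 = ρ' v := by
  rw [interpolate, one_mul, Real.exp_log (div_pos (hρ' v) (hρ v)), mul_div_cancel₀ _ (hρ v).ne']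

theorem hasDerivAt_interpolate (ρ ρ' : V → ℝ) (v : V) (t : ℝ) :
    HasDerivAt (interpolate ρ ρ' v) (interpolate ρ ρ' v t * Real.log (ρ' v / ρ v)) t := by
  have h := (((hasDerivAt_id t).mul_const (Real.log (ρ' v / ρ v))).exp).const_mul (ρ v)
  refine h.congr_deriv ?_
  simp only [interpolate, id]
  ring

theorem continuous_interpolate (ρ ρ' : V → ℝ) (v : V) : Continuous (interpolate ρ ρ' v) := by
  unfold interpolate
  fun_prop

/-- The inradius of the triangle `Δ` for the interpolated label. -/
def inradius (ρ ρ' : V → ℝ) (Δ : Finset V) (t : ℝ) : ℝ :=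
  √((∏ u ∈ Δ, interpolate ρ ρ' u t) / ∑ u ∈ Δ, interpolate ρ ρ' u t)

/-- The contribution of the triangle `Δ` to the conductance of the edge `{v, w}`. -/
def angleConductance (ρ ρ' : V → ℝ) (Δ : Finset V) (v w : V) : ℝ :=
  ∫ t in (0 : ℝ)..1, inradius ρ ρ' Δ t / (interpolate ρ ρ' v t + interpolate ρ ρ' w t)

theorem angleConductance_comm (ρ ρ' : V → ℝ) (Δ : Finset V) (v w : V) :
    angleConductance ρ ρ' Δ v w = angleConductance ρ ρ' Δ w v := by
  simp only [angleConductance, add_comm]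

theorem continuous_inradius {ρ : V → ℝ} (hρ : IsLabel ρ) (ρ' : V → ℝ) {Δ : Finset V}
    (hΔ : Δ.Nonempty) : Continuous (inradius ρ ρ' Δ) := by
  refine Continuous.sqrt (Continuous.div ?_ ?_ fun t => ?_)
  · exact continuous_finsetProd _ fun u _ => continuous_interpolate ρ ρ' u
  · exact continuous_finsetSum _ fun u _ => continuous_interpolate ρ ρ' u
  · exact (Finset.sum_pos (fun u _ => interpolate_pos hρ ρ' u t) hΔ).ne'

theorem inradius_pos {ρ : V → ℝ} (hρ : IsLabel ρ) (ρ' : V → ℝ) {Δ : Finset V}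
    (hΔ : Δ.Nonempty) (t : ℝ) : 0 < inradius ρ ρ' Δ t :=
  Real.sqrt_pos.2 (div_pos (Finset.prod_pos fun u _ => interpolate_pos hρ ρ' u t)
    (Finset.sum_pos (fun u _ => interpolate_pos hρ ρ' u t) hΔ))

theorem continuous_angleConductance_integrand {ρ : V → ℝ} (hρ : IsLabel ρ) (ρ' : V → ℝ)
    {Δ : Finset V} (hΔ : Δ.Nonempty) (v w : V) :
    Continuous fun t => inradius ρ ρ' Δ t / (interpolate ρ ρ' v t + interpolate ρ ρ' w t) :=
  (continuous_inradius hρ ρ' hΔ).div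
    ((continuous_interpolate ρ ρ' v).add (continuous_interpolate ρ ρ' w))
    fun t => (add_pos (interpolate_pos hρ ρ' v t) (interpolate_pos hρ ρ' w t)).ne'

theorem angleConductance_pos {ρ : V → ℝ} (hρ : IsLabel ρ) (ρ' : V → ℝ) {Δ : Finset V}
    (hΔ : Δ.Nonempty) (v w : V) : 0 < angleConductance ρ ρ' Δ v w :=
  intervalIntegral.intervalIntegral_pos_of_pos
    ((continuous_angleConductance_integrand hρ ρ' hΔ v w).intervalIntegrable _ _)
    (fun t => div_pos (inradius_pos hρ ρ' hΔ t)
      (add_pos (interpolate_pos hρ ρ' v t) (interpolate_pos hρ ρ' w t))) one_pos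

theorem inradius_triple [DecidableEq V] (ρ ρ' : V → ℝ) {v w u : V} (hvw : v ≠ w) (hvu : v ≠ u)
    (hwu : w ≠ u) (t : ℝ) : inradius ρ ρ' {v, w, u} t =
      √(interpolate ρ ρ' v t * interpolate ρ ρ' w t * interpolate ρ ρ' u t /
        (interpolate ρ ρ' v t + interpolate ρ ρ' w t + interpolate ρ ρ' u t)) := by
  have h : v ∉ ({w, u} : Finset V) := by simp [hvw, hvu]
  rw [inradius, Finset.prod_insert h, Finset.sum_insert h, Finset.prod_pair hwu,
    Finset.sum_pair hwu, mul_assoc, add_assoc]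

/-- The squared inradius `abc / (a + b + c)` is at most `ab`, hence at most `((a + b) / 2) ^ 2`. -/
theorem angleConductance_le {ρ : V → ℝ} (hρ : IsLabel ρ) (ρ' : V → ℝ) {Δ : Finset V}
    (h3 : Δ.card = 3) {v w : V} (hv : v ∈ Δ) (hw : w ∈ Δ) (hvw : v ≠ w) :
    angleConductance ρ ρ' Δ v w ≤ 1 / 2 := by
  classical
  obtain ⟨u, hvu, hwu, rfl⟩ := exists_eq_triple h3 hv hw hvw
  have h1 : ∀ t, inradius ρ ρ' {v, w, u} t / (interpolate ρ ρ' v t + interpolate ρ ρ' w t) ≤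
      1 / 2 := by
    intro t
    have hv := interpolate_pos hρ ρ' v t
    have hw := interpolate_pos hρ ρ' w t
    have hu := interpolate_pos hρ ρ' u t
    rw [div_le_iff₀ (by positivity), inradius_triple ρ ρ' hvw hvu hwu]
    refine Real.sqrt_le_iff.2 ⟨by positivity, ?_⟩
    generalize interpolate ρ ρ' v t = a at *
    generalize interpolate ρ ρ' w t = b at *
    generalize interpolate ρ ρ' u t = c at *
    calc a * b * c / (a + b + c) ≤ a * b := by
          rw [div_le_iff₀ (by positivity)]
          have : 0 < a * b := by positivity
          nlinarith
      _ ≤ (1 / 2 * (a + b)) ^ 2 := by nlinarith [sq_nonneg (a - b)]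
  calc _ ≤ ∫ _ in (0 : ℝ)..1, (1 / 2 : ℝ) :=
        intervalIntegral.integral_mono_on zero_le_one
          ((continuous_angleConductance_integrand hρ ρ' ⟨v, hv⟩ v w).intervalIntegrable _ _)
          (continuous_const.intervalIntegrable _ _) fun t _ => h1 t
    _ = 1 / 2 := by simp

open Classical in
/-- The change of an angle between two labels is a weighted sum of differences of the logarithmic
ratio of the labels. -/
theorem angle_sub_angle {ρ ρ' : V → ℝ} (hρ : IsLabel ρ) (hρ' : IsLabel ρ') {Δ : Finset V}
    (h3 : Δ.card = 3) {v : V} (hv : v ∈ Δ) :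
    angle ρ' v Δ - angle ρ v Δ = ∑ w ∈ Δ.erase v, angleConductance ρ ρ' Δ v w *
      (Real.log (ρ' w / ρ w) - Real.log (ρ' v / ρ v)) := by
  obtain ⟨w, hw⟩ : (Δ.erase v).Nonempty := by
    rw [← Finset.card_pos, Finset.card_erase_of_mem hv, h3]
    norm_num
  obtain ⟨hwv, hw⟩ := Finset.mem_erase.1 hw
  obtain ⟨u, hvu, hwu, rfl⟩ := exists_eq_triple h3 hv hw hwv.symm
  have herase : ({v, w, u} : Finset V).erase v = {w, u} :=
    Finset.erase_insert (by simp [hwv.symm, hvu])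
  have hd : ∀ t, HasDerivAt (fun s => angle (fun x => interpolate ρ ρ' x s) v {v, w, u})
      (inradius ρ ρ' {v, w, u} t / (interpolate ρ ρ' v t + interpolate ρ ρ' w t) *
          (Real.log (ρ' w / ρ w) - Real.log (ρ' v / ρ v)) +
        inradius ρ ρ' {v, w, u} t / (interpolate ρ ρ' v t + interpolate ρ ρ' u t) *
          (Real.log (ρ' u / ρ u) - Real.log (ρ' v / ρ v))) t := by
    intro t
    have h := hasDerivAt_arccos_angle (interpolate_pos hρ ρ' v t) (interpolate_pos hρ ρ' w t)
      (interpolate_pos hρ ρ' u t) (hasDerivAt_interpolate ρ ρ' v t)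
      (hasDerivAt_interpolate ρ ρ' w t) (hasDerivAt_interpolate ρ ρ' u t)
    rw [← inradius_triple ρ ρ' hwv.symm hvu hwu] at h
    refine h.congr_of_eventuallyEq (Eventually.of_forall fun s => ?_)
    rw [Finset.insert_comm]
    simp only [angle_eq _ hwv hvu hwu, mul_assoc]
  have hint : ∀ x, IntervalIntegrable (fun t => inradius ρ ρ' {v, w, u} t /
      (interpolate ρ ρ' v t + interpolate ρ ρ' x t) *
        (Real.log (ρ' x / ρ x) - Real.log (ρ' v / ρ v))) volume 0 1 := fun x =>
    ((continuous_angleConductance_integrand hρ ρ' ⟨v, hv⟩ v x).intervalIntegrable _ _).mul_const _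
  -- The logarithmic ratios do not depend on `t`, so they come out of the integral.
  have hftc := intervalIntegral.integral_eq_sub_of_hasDerivAt (a := 0) (b := 1)
    (fun t _ => hd t) ((hint w).add (hint u))
  simp only [interpolate_zero, interpolate_one hρ hρ'] at hftc
  rw [intervalIntegral.integral_add (hint w) (hint u), intervalIntegral.integral_mul_const,
    intervalIntegral.integral_mul_const] at hftc
  rw [herase, Finset.sum_pair hwu]
  exact hftc.symm

end Angles

/-! ### The conductances of a pair of labels -/

section Comparison

variable {V : Type*} {K : AbstractSimplicialComplex V}

theorem oneSkeleton_adj_of_mem {Δ : Finset V} (hΔ : Δ ∈ K.faces) {v w : V} (hv : v ∈ Δ)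
    (hw : w ∈ Δ) (hvw : v ≠ w) : (oneSkeleton K).Adj v w := by
  classical
  refine ⟨hvw, (K.isRelLowerSet_faces hΔ).2 ?_ ⟨v, by simp⟩⟩
  intro x hx
  simp only [Finset.mem_insert, Finset.mem_singleton] at hx
  rcases hx with rfl | rfl <;> assumption

theorem finite_triangles [(oneSkeleton K).LocallyFinite] (v : V) :
    {Δ | Δ ∈ K.faces ∧ Δ.card = 3 ∧ v ∈ Δ}.Finite := by
  classical
  refine (insert v ((oneSkeleton K).neighborFinset v)).powerset.finite_toSet.subset ?_
  rintro Δ ⟨hΔ, -, hv⟩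
  rw [Finset.mem_coe, Finset.mem_powerset]
  intro w hw
  by_cases h : w = v
  · simp [h]
  · refine Finset.mem_insert_of_mem ?_
    rw [SimpleGraph.mem_neighborFinset]
    exact oneSkeleton_adj_of_mem hΔ hv hw (Ne.symm h)

/-- The triangles at a vertex. -/
def triangles (K : AbstractSimplicialComplex V) [(oneSkeleton K).LocallyFinite] (v : V) :
    Finset (Finset V) := (finite_triangles (K := K) v).toFinset

theorem mem_triangles [(oneSkeleton K).LocallyFinite] {v : V} {Δ : Finset V} :
    Δ ∈ triangles K v ↔ Δ ∈ K.faces ∧ Δ.card = 3 ∧ v ∈ Δ := by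
  rw [triangles, Set.Finite.mem_toFinset, Set.mem_ofPred_eq]

theorem angleSum_eq_sum [(oneSkeleton K).LocallyFinite] (ρ : V → ℝ) (v : V) :
    angleSum K ρ v = ∑ Δ ∈ triangles K v, angle ρ v Δ := by
  rw [angleSum]
  exact finsum_mem_eq_finite_toFinset_sum _ (finite_triangles (K := K) v)

open Classical in
/-- The conductance of an edge: the total contribution of the triangles that contain it. -/
def labelConductance (K : AbstractSimplicialComplex V) [(oneSkeleton K).LocallyFinite]
    (ρ ρ' : V → ℝ) (v w : V) : ℝ :=
  if (oneSkeleton K).Adj v w then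
    ∑ Δ ∈ (triangles K v).filter (fun Δ => w ∈ Δ), angleConductance ρ ρ' Δ v w
  else 0

/-- Plane topology enters here: `exists_triangle` gives positivity, and `card_triangles_le_two` with
the bound 1/2 per triangle gives the bound 1. -/
theorem isConductance_labelConductance [(oneSkeleton K).LocallyFinite] {D : Set ℂ}
    (hD : IsOpen D) (hK : IsTriangulationOf K D) {ρ : V → ℝ} (hρ : IsLabel ρ) (ρ' : V → ℝ) :
    IsConductance (oneSkeleton K) (labelConductance K ρ ρ') where
  symm v w := by
    classical
    have h : (triangles K v).filter (fun Δ => w ∈ Δ) =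
        (triangles K w).filter (fun Δ => v ∈ Δ) := by
      ext Δ
      simp only [Finset.mem_filter, mem_triangles]
      tauto
    rw [labelConductance, labelConductance, (oneSkeleton K).adj_comm, h]
    simp only [angleConductance_comm ρ ρ' _ v w]
  pos v w hvw := by
    classical
    rw [labelConductance, if_pos hvw]
    obtain ⟨Δ, hΔ, h3, hv, hw⟩ := exists_triangle hD hK hvw
    refine Finset.sum_pos (fun Δ hΔ => ?_)
      ⟨Δ, Finset.mem_filter.2 ⟨mem_triangles.2 ⟨hΔ, h3, hv⟩, hw⟩⟩
    exact angleConductance_pos hρ ρ' ⟨w, (Finset.mem_filter.1 hΔ).2⟩ v w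
  le_one v w hvw := by
    classical
    rw [labelConductance, if_pos hvw]
    have hT : ∀ Δ ∈ (triangles K v).filter (fun Δ => w ∈ Δ),
        Δ ∈ K.faces ∧ Δ.card = 3 ∧ v ∈ Δ ∧ w ∈ Δ := by
      intro Δ hΔ
      rw [Finset.mem_filter, mem_triangles] at hΔ
      tauto
    have hcard := card_triangles_le_two hK hvw.1 _ hT
    refine (Finset.sum_le_card_nsmul _ _ (1 / 2) fun Δ hΔ => ?_).trans ?_
    · obtain ⟨-, h3, hv, hw⟩ := hT Δ hΔ
      exact angleConductance_le hρ ρ' h3 hv hw hvw.1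
    · rw [nsmul_eq_mul]
      have : ((Finset.card ((triangles K v).filter (fun Δ => w ∈ Δ)) : ℕ) : ℝ) ≤ 2 := by
        exact_mod_cast hcard
      linarith
  eq_zero v w hvw := by rw [labelConductance, if_neg hvw]

/-- Sum `angle_sub_angle` over the triangles at `v` and regroup by the edges at `v`. -/
theorem angleSum_sub_angleSum [(oneSkeleton K).LocallyFinite] {ρ ρ' : V → ℝ} (hρ : IsLabel ρ)
    (hρ' : IsLabel ρ') (v : V) : angleSum K ρ' v - angleSum K ρ v =
      ∑ w ∈ (oneSkeleton K).neighborFinset v, labelConductance K ρ ρ' v w *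
        (Real.log (ρ' w / ρ w) - Real.log (ρ' v / ρ v)) := by
  classical
  rw [angleSum_eq_sum, angleSum_eq_sum, ← Finset.sum_sub_distrib]
  have h1 : ∀ w ∈ (oneSkeleton K).neighborFinset v, labelConductance K ρ ρ' v w *
        (Real.log (ρ' w / ρ w) - Real.log (ρ' v / ρ v)) =
      ∑ Δ ∈ (triangles K v).filter (fun Δ => w ∈ Δ), angleConductance ρ ρ' Δ v w *
        (Real.log (ρ' w / ρ w) - Real.log (ρ' v / ρ v)) := by
    intro w hw
    rw [SimpleGraph.mem_neighborFinset] at hw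
    rw [labelConductance, if_pos hw, Finset.sum_mul]
  rw [Finset.sum_congr rfl h1, Finset.sum_congr rfl fun Δ hΔ =>
    angle_sub_angle hρ hρ' (mem_triangles.1 hΔ).2.1 (mem_triangles.1 hΔ).2.2]
  refine Finset.sum_comm' fun Δ w => ?_
  simp only [Finset.mem_erase, Finset.mem_filter, SimpleGraph.mem_neighborFinset]
  refine ⟨fun ⟨hΔ, hwv, hw⟩ => ⟨⟨hΔ, hw⟩, ?_⟩, fun ⟨⟨hΔ, hw⟩, hadj⟩ => ⟨hΔ, hadj.1.symm, hw⟩⟩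
  obtain ⟨hface, -, hv⟩ := mem_triangles.1 hΔ
  exact oneSkeleton_adj_of_mem hface hv hw hwv.symm

end Comparison

end LabelledComplex
end

theorem theorem3p1 {V : Type*} (K : AbstractSimplicialComplex V) (D : Set ℂ)
    (hD : IsOpen D) (hconn : IsConnected D)
    (hK : LabelledComplex.IsTriangulationOf K D)
    (hrec : LabelledComplex.IsRecurrentGraph (LabelledComplex.oneSkeleton K))
    (ρ ρ' : V → ℝ) (hρ : LabelledComplex.IsLabel ρ) (hρ' : LabelledComplex.IsLabel ρ')
    (hsub : LabelledComplex.IsSubpacking K ρ' (LabelledComplex.angleSum K ρ)) :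
    (∃ M : ℝ, ∀ v, ρ' v / ρ v ≤ M) ↔ ∃ c : ℝ, ∀ v, ρ' v / ρ v = c := by
  open LabelledComplex in
  refine ⟨fun ⟨M, hM⟩ => ?_, fun ⟨c, hc⟩ => ⟨c, fun v => (hc v).le⟩⟩
  rcases isEmpty_or_nonempty V with hV | ⟨⟨a⟩⟩
  · exact ⟨0, fun v => hV.elim v⟩
  have : (oneSkeleton K).LocallyFinite := fun v => (hrec.neighborSet_finite v).fintype
  have hA : ∀ v, 0 < ρ' v / ρ v := fun v => div_pos (hρ' v) (hρ v)
  have hconst := hrec.superharmonic_const (isConductance_labelConductance hD hK hρ ρ')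
    -- The summand 1 makes the function strictly positive even where the ratio attains `M`.
    (g := fun v => Real.log M + 1 - Real.log (ρ' v / ρ v))
    (fun v => by linarith [Real.log_le_log (hA v) (hM v)])
    (fun v => by
      have h := hsub v
      rw [← sub_nonneg, angleSum_sub_angleSum hρ hρ'] at h
      refine h.trans_eq (Finset.sum_congr rfl fun w _ => ?_)
      ring) a
  refine ⟨ρ' a / ρ a, fun v => Real.log_injOn_pos (hA v) (hA a) ?_⟩
  linarith [hconst v]
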